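/- Fix an integer $k\ge 2$, and work with formal series in $q$ over $\mathbb{C}$. For $1\le i\le k$ put $$B_i=\frac{\prod_{m\ge 1}(1-q^{2km})(1-q^{2km-k+i-1})(1-q^{2km-k-i+1})}{\prod_{s\ge1}(1-q^s)}.$$ Define the official series $B_r$ ($r\ge 1$) and the ghost series $\tilde B_r$ ($r\ge 2$) on the successive shelves $j=0,1,2,\dots$ as follows. Given the official series $B_{(k-1)j+1},\dots,B_{(k-1)j+k}$ of shelf $j$, the ghosts of shelf $j$ are $$\tilde B_{(k-1)j+i}=\frac{B_{(k-1)j+i-1}+q^{j+1}B_{(k-1)j+i+1}}{1+q^{j+1}}\quad(2\le i\le k-1),\qquad \tilde B_{(k-1)j+k}=\frac{B_{(k-1)j+k-1}}{1+q^{j+1}},$$ and the official series of shelf $j+1$ are $B_{(k-1)(j+1)+1}=B_{(k-1)j+k}$ (the same index) and $$B_{(k-1)(j+1)+i}=\frac{B_{(k-1)j+k-i+1}-\tilde B_{(k-1)j+k-i+2}}{q^{(j+1)(i-1)}}\quad(2\le i\le k);$$ a priori these are formal Laurent series. Theorem. For every $J\ge 0$, every $i\in\{1,\dots,k\}$ and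 $r=(k-1)J+i$, the series $B_r$ is a formal power series, and $$B_r=\sum_{n\ge 0}b_{k,r}(n)\,q^n,$$ where $b_{k,r}(n)$ is the number of partitions $\pi=(\pi_1\ge\pi_2\ge\dots\ge\pi_{\ell})$ of $n$ into positive parts ($\ell=\ell(\pi)$ being the number of parts) such that 1. $\pi_t-\pi_{t+k-1}\ge 2$ for all $t\ge1$ with $t+k-1\le \ell$; 2. every part of $\pi$ is at least $J+1$; 3. the part $J+1$ occurs at most $k-i$ times in $\pi$; 4. for all $t\ge 1$ with $t+k-2\le \ell$: $\pi_t-\pi_{t+k-2}\le 1$ only if $\pi_t+\pi_{t+1}+\dots+\pi_{t+k-2}\equiv r+k\pmod 2$. -/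

import Mathlib

open scoped PowerSeries LaurentSeries

namespace AndrewsBressoud

noncomputable section

/-! ### The official and ghost series

All series live in the field `ℂ⸨X⸩` of formal Laurent series, so that the divisions in the
recursions are genuine divisions in a field. The formal variable is `q = X`. -/

/-- The formal variable `q`, as a Laurent series. -/
def q : ℂ⸨X⸩ := ((PowerSeries.X : ℂ⟦X⟧) : ℂ⸨X⸩)

open scoped PowerSeries.WithPiTopology in
/-- `(q)_∞ = ∏_{s ≥ 1} (1 - q^s)`, an infinite product of formal power series
(the index is shifted by one). -/
def qInf : ℂ⟦X⟧ := ∏' s : ℕ, (1 - PowerSeries.X ^ (s + 1))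

/-- The factor `(1 - q^{2km}) (1 - q^{2km-k+i-1}) (1 - q^{2km-k-i+1})`. For `m ≥ 1` and
`1 ≤ i ≤ k` no subtraction is truncated, and all three exponents are positive. -/
def thetaFactor (k i m : ℕ) : ℂ⟦X⟧ :=
  (1 - PowerSeries.X ^ (2 * k * m)) * (1 - PowerSeries.X ^ (2 * k * m - k + i - 1)) *
    (1 - PowerSeries.X ^ (2 * k * m - k - i + 1))

open scoped PowerSeries.WithPiTopology in
/-- `∏_{m ≥ 1} (1 - q^{2km}) (1 - q^{2km-k+i-1}) (1 - q^{2km-k-i+1})`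
(the index is shifted by one). -/
def thetaProd (k i : ℕ) : ℂ⟦X⟧ := ∏' m : ℕ, thetaFactor k i (m + 1)

/-- The ghost `B̃_{(k-1)j+i}`, `2 ≤ i ≤ k`, in terms of the official series `S i = B_{(k-1)j+i}`,
`1 ≤ i ≤ k`, on the same shelf `j`. -/
def ghostOf (k j : ℕ) (S : ℕ → ℂ⸨X⸩) (i : ℕ) : ℂ⸨X⸩ :=
  if i = k then S (k - 1) / (1 + q ^ (j + 1))
  else (S (i - 1) + q ^ (j + 1) * S (i + 1)) / (1 + q ^ (j + 1))

/-- `officialShelf k j i`, for `1 ≤ i ≤ k`, is the `i`-th official series on the `j`-th shelf. -/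
def officialShelf (k : ℕ) : ℕ → ℕ → ℂ⸨X⸩
  | 0, i => ((thetaProd k i : ℂ⟦X⟧) : ℂ⸨X⸩) / ((qInf : ℂ⟦X⟧) : ℂ⸨X⸩)
  | j + 1, i =>
    if i = 1 then officialShelf k j k
    else (officialShelf k j (k - i + 1) - ghostOf k j (officialShelf k j) (k - i + 2)) /
      q ^ ((j + 1) * (i - 1))

/-- The official series `B_r`, `r ≥ 1`: here `r = (k-1)j + i` with `j = (r-1)/(k-1)` and
`1 ≤ i ≤ k-1`. The boundary case `i = k` is `series_eq_shelf` below. -/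
def officialSeries (k r : ℕ) : ℂ⸨X⸩ :=
  officialShelf k ((r - 1) / (k - 1)) ((r - 1) % (k - 1) + 1)

/-- The ghost series `B̃_r`, `r ≥ 2`: here `r = (k-1)j + i` with `j = (r-2)/(k-1)` and
`2 ≤ i ≤ k`. -/
def ghostSeries (k r : ℕ) : ℂ⸨X⸩ :=
  ghostOf k ((r - 2) / (k - 1)) (officialShelf k ((r - 2) / (k - 1))) ((r - 2) % (k - 1) + 2)

end

/-! ### The definitions are the intended ones -/

theorem one_add_q_pow_ne_zero (j : ℕ) : (1 + q ^ (j + 1) : ℂ⸨X⸩) ≠ 0 := by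
  have h : (1 + q ^ (j + 1) : ℂ⸨X⸩) = ((1 + PowerSeries.X ^ (j + 1) : ℂ⟦X⟧) : ℂ⸨X⸩) := by
    simp [q]
  rw [h]
  intro h0
  have h1 : (1 + PowerSeries.X ^ (j + 1) : ℂ⟦X⟧) = 0 :=
    HahnSeries.ofPowerSeries_injective (Γ := ℤ) (h0.trans (map_zero _).symm)
  have := congrArg PowerSeries.constantCoeff h1
  simp at this

theorem q_ne_zero : q ≠ 0 := by
  intro h0
  exact PowerSeries.X_ne_zero (R := ℂ)
    (HahnSeries.ofPowerSeries_injective (Γ := ℤ) (h0.trans (map_zero _).symm))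

open scoped PowerSeries.WithPiTopology in
theorem multipliable_qInf :
    Multipliable fun s : ℕ => (1 - PowerSeries.X ^ (s + 1) : ℂ⟦X⟧) :=
  PowerSeries.WithPiTopology.multipliable_one_sub_X_pow ℂ

open scoped PowerSeries.WithPiTopology in
theorem multipliable_thetaProd (k i : ℕ) (hi : 1 ≤ i) (hik : i ≤ k) :
    Multipliable fun m : ℕ => thetaFactor k i (m + 1) := by
  have key : ∀ e : ℕ → ℕ, (∀ m, m ≤ e m) →
      Multipliable fun m : ℕ => (1 - PowerSeries.X ^ (e m) : ℂ⟦X⟧) := by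
    intro e he
    simp_rw [sub_eq_add_neg]
    apply PowerSeries.WithPiTopology.multipliable_one_add_of_tendsto_order_atTop_nhds_top
    simp_rw [PowerSeries.order_neg, PowerSeries.order_X_pow]
    rw [ENat.tendsto_nhds_top_iff_natCast_lt]
    intro n
    filter_upwards [Filter.eventually_gt_atTop n] with m hm
    exact_mod_cast lt_of_lt_of_le hm (he m)
  have hk : ∀ m, m + 2 * k ≤ 2 * k * (m + 1) + 0 := by
    intro m
    nlinarith [Nat.zero_le m]
  refine ((key _ fun m => ?_).mul (key _ fun m => ?_)).mul (key _ fun m => ?_)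
  all_goals have := hk m; omega

/-- The two ways of writing the index `r = (k-1)(J+1) + 1 = (k-1)J + k` give the same series. -/
theorem series_eq_shelf (k J i : ℕ) (hk : 2 ≤ k) (hi : 1 ≤ i) (hik : i ≤ k) :
    officialSeries k ((k - 1) * J + i) = officialShelf k J i := by
  obtain ⟨k, rfl⟩ : ∃ k', k = k' + 1 := ⟨k - 1, by omega⟩
  obtain ⟨i, rfl⟩ : ∃ i', i = i' + 1 := ⟨i - 1, by omega⟩
  have hk0 : 0 < k := by omega
  unfold officialSeries
  simp only [Nat.add_sub_cancel, ← Nat.add_assoc]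
  rcases Nat.lt_or_ge i k with h | h
  · simp only [Nat.mul_add_div hk0, Nat.mul_add_mod, Nat.div_eq_of_lt h, Nat.mod_eq_of_lt h,
      Nat.add_zero]
  · obtain rfl : i = k := by omega
    rw [Nat.mul_add_div hk0, Nat.mul_add_mod, Nat.div_self hk0, Nat.mod_self]
    simp [officialShelf]

theorem ghostSeries_eq (k j i : ℕ) (hk : 2 ≤ k) (hi : 2 ≤ i) (hik : i ≤ k) :
    ghostSeries k ((k - 1) * j + i) = ghostOf k j (officialShelf k j) i := by
  obtain ⟨k, rfl⟩ : ∃ k', k = k' + 1 := ⟨k - 1, by omega⟩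
  obtain ⟨i, rfl⟩ : ∃ i', i = i' + 2 := ⟨i - 2, by omega⟩
  have hk0 : 0 < k := by omega
  have h : i < k := by omega
  unfold ghostSeries
  simp only [Nat.add_sub_cancel, ← Nat.add_assoc]
  simp only [Nat.mul_add_div hk0, Nat.mul_add_mod, Nat.div_eq_of_lt h, Nat.mod_eq_of_lt h,
    Nat.add_zero]

/-- The zeroth shelf. -/
theorem officialSeries_zero (k i : ℕ) (hk : 2 ≤ k) (hi : 1 ≤ i) (hik : i ≤ k) :
    officialSeries k i = ((thetaProd k i : ℂ⟦X⟧) : ℂ⸨X⸩) / ((qInf : ℂ⟦X⟧) : ℂ⸨X⸩) := by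
  simpa [officialShelf] using series_eq_shelf k 0 i hk hi hik

/-- `B_{(k-1)(j+1)+i} = (B_{(k-1)j+k-i+1} - B̃_{(k-1)j+k-i+2}) / q^{(j+1)(i-1)}`
for `2 ≤ i ≤ k`. -/
theorem officialSeries_succ (k j i : ℕ) (hk : 2 ≤ k) (hi : 2 ≤ i) (hik : i ≤ k) :
    officialSeries k ((k - 1) * (j + 1) + i) =
      (officialSeries k ((k - 1) * j + (k - i + 1)) -
        ghostSeries k ((k - 1) * j + (k - i + 2))) / q ^ ((j + 1) * (i - 1)) := by
  rw [series_eq_shelf k (j + 1) i hk (by omega) hik,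
    series_eq_shelf k j (k - i + 1) hk (by omega) (by omega),
    ghostSeries_eq k j (k - i + 2) hk (by omega) (by omega)]
  simp [officialShelf, show i ≠ 1 by omega]

/-- `B_{(k-1)(j+1)+2} = B̃_{(k-1)j+k}`. -/
theorem officialSeries_succ_two (k j : ℕ) (hk : 2 ≤ k) :
    officialSeries k ((k - 1) * (j + 1) + 2) = ghostSeries k ((k - 1) * j + k) := by
  have h := officialSeries_succ k j 2 hk le_rfl hk
  have hg := ghostSeries_eq k j k hk hk le_rfl
  rw [show k - 2 + 2 = k by omega, show k - 2 + 1 = k - 1 by omega] at h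
  rw [h, hg, series_eq_shelf k j (k - 1) hk (by omega) (by omega)]
  have h1 := one_add_q_pow_ne_zero j
  have h2 := q_ne_zero
  simp only [ghostOf, if_true, Nat.add_one_sub_one, mul_one]
  field_simp
  ring

theorem shelf_field_identity {K : Type*} [Field K] (A C w v : K)
    (hw1 : 1 + w ≠ 0) (hw : w ≠ 0) (hv : v ≠ 0) :
    (A - (A + w * C) / (1 + w)) / (v * w) = ((A + w * C) / (1 + w) - C) / v := by
  field_simp
  ring

/-- `B_{(k-1)(j+1)+i} = (B̃_{(k-1)j+k-i+2} - B_{(k-1)j+k-i+3}) / q^{(j+1)(i-2)}`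
for `3 ≤ i ≤ k`. -/
theorem officialSeries_succ' (k j i : ℕ) (hk : 2 ≤ k) (hi : 3 ≤ i) (hik : i ≤ k) :
    officialSeries k ((k - 1) * (j + 1) + i) =
      (ghostSeries k ((k - 1) * j + (k - i + 2)) -
        officialSeries k ((k - 1) * j + (k - i + 3))) / q ^ ((j + 1) * (i - 2)) := by
  rw [officialSeries_succ k j i hk (by omega) hik,
    series_eq_shelf k j (k - i + 1) hk (by omega) (by omega),
    series_eq_shelf k j (k - i + 3) hk (by omega) (by omega),
    ghostSeries_eq k j (k - i + 2) hk (by omega) (by omega)]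
  have h1 := one_add_q_pow_ne_zero j
  have h2 := q_ne_zero
  have e : q ^ ((j + 1) * (i - 1)) = q ^ ((j + 1) * (i - 2)) * q ^ (j + 1) := by
    rw [← pow_add, ← Nat.mul_succ, show (i - 2).succ = i - 1 by omega]
  have g : ghostOf k j (officialShelf k j) (k - i + 2) =
      (officialShelf k j (k - i + 1) + q ^ (j + 1) * officialShelf k j (k - i + 3)) /
        (1 + q ^ (j + 1)) := by
    unfold ghostOf
    rw [if_neg (by omega)]
    rfl
  rw [e, g]
  exact shelf_field_identity _ _ _ _ h1 (pow_ne_zero _ h2) (pow_ne_zero _ h2)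

/-! ### The partitions -/

/-- The parts of a partition as a nonincreasing list. -/
def sortedParts {n : ℕ} (p : n.Partition) : List ℕ := p.parts.sort (· ≥ ·)

/-- `part p t` is the part `π_{t+1}` of `π = (π_1 ≥ π_2 ≥ ⋯)`; it is only used for
`t + 1 ≤ ℓ(π)`. -/
def part {n : ℕ} (p : n.Partition) (t : ℕ) : ℕ := (sortedParts p).getD t 0

/-- The partitions counted by `b_{k,r}(n)`, with `r = (k-1)J + i`. -/
structure IsAdmissible (k J i : ℕ) {n : ℕ} (p : n.Partition) : Prop where
  /-- `π_t - π_{t+k-1} ≥ 2` whenever both parts exist -/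
  difference : ∀ t, t + (k - 1) < p.parts.card → part p (t + (k - 1)) + 2 ≤ part p t
  /-- all parts are at least `J + 1` -/
  smallest : ∀ a ∈ p.parts, J + 1 ≤ a
  /-- `m_{J+1}(π) ≤ k - i` -/
  multiplicity : p.parts.count (J + 1) ≤ k - i
  /-- `π_t - π_{t+k-2} ≤ 1` only if `π_t + ⋯ + π_{t+k-2} ≡ r + k (mod 2)` -/
  parity : ∀ t, t + (k - 2) < p.parts.card → part p t ≤ part p (t + (k - 2)) + 1 →
    ∑ s ∈ Finset.range (k - 1), part p (t + s) ≡ ((k - 1) * J + i) + k [MOD 2]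

open Classical in
/-- `b_{k,r}(n)` for `r = (k-1)J + i`: the number of admissible partitions of `n`. -/
noncomputable def admissibleCount (k J i n : ℕ) : ℕ :=
  (Finset.univ.filter fun p : n.Partition => IsAdmissible k J i p).card

end AndrewsBressoud

/-!
Write `S_j = (q)_∞ (1 + q) ⋯ (1 + q^j)` (`shelfDenom`). The official series have the closed form
`B_{(k-1)j+i} = N_{j,i} / S_j`, where (`shelfSum`)

`N_{j,i} = ∑_{n ≥ 0} (-1)^n q^{kn² + ((k-1)j+i-1)n} ∏_{s=1}^{j} (1 - q^{2(n+s)})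
  (1 - q^{(k+1-i)(2n+1+j)})`.

On the zeroth shelf this is the Jacobi triple product (`thetaProd_eq_shelfSum`), which is obtained
as the limit of the `Q`-binomial theorem with `Q = q^{2k}` (`finite_triple_product`). The passage
to the next shelf amounts to
`N_{j,k-i+1} - N_{j,k-i+3} = q^{(j+1)(i-2)} N_{j+1,i}` for `2 ≤ i ≤ k`, where `N_{j,k+1} = 0`, and
`(1 + q^{j+1}) N_{j,k} = N_{j+1,1}`; both follow by splitting the sum in two and shifting the index
in one of the parts (`shelfSum_sub`, `shelfSum_succ_one`).

The generating functions `A_{j,i}` of the admissible partitions (`admissibleGF`) satisfy the same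
recursion after multiplication by `S_j`. Indeed, admissibility says that the multiplicities of
consecutive integers satisfy `m_a + m_{a+1} ≤ k - 1`, with a parity condition on
`a m_a + (a+1) m_{a+1}` in the case of equality (`isAdmissible_iff`). Partitions counted by
`A_{j,k-i+1}` but not by `A_{j,k-i+3}` have `i - 1` or `i - 2` parts `j + 1`, and because of the
parity condition the remaining parts form in both cases an arbitrary partition counted by
`A_{j+1,i}` (`isAdmissibleMultiset_replicate_add_iff`).

Finally, the recursion expresses the shelf `j` through the shelf `j + 1` with coefficients that are
power series, and both `N_{j,i}` and `S_j A_{j,i}` are congruent to `S_j` modulo `q^j`. Hence their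
difference is divisible by arbitrarily high powers of `q`, so it vanishes (`shelfSum_eq`).
-/

namespace AndrewsBressoud

/-! ### Admissibility in terms of multiplicities -/

/-- The number of parts that are at least `b`, i.e. a part of the conjugate partition. -/
def numGE (s : Multiset ℕ) (b : ℕ) : ℕ := s.countP (b ≤ ·)

theorem numGE_eq_add_count (s : Multiset ℕ) (b : ℕ) :
    numGE s b = numGE s (b + 1) + s.count b := by
  induction s using Multiset.induction_on with
  | empty => simp [numGE]
  | cons x s ih =>
    simp only [numGE, Multiset.countP_cons, Multiset.count_cons] at ih ⊢
    rw [ih]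
    split_ifs <;> omega

theorem numGE_le_card (s : Multiset ℕ) (b : ℕ) : numGE s b ≤ s.card :=
  Multiset.countP_le_card _ _

theorem numGE_eq_card {s : Multiset ℕ} {b : ℕ} (h : ∀ a ∈ s, b ≤ a) : numGE s b = s.card :=
  Multiset.countP_eq_card.2 h

/-- In a nonincreasing list, the entries that are at least `b` form an initial segment. -/
theorem le_getD_iff_lt_countP {l : List ℕ} (hl : l.Pairwise (· ≥ ·)) {b : ℕ} (hb : 1 ≤ b)
    (t : ℕ) : b ≤ l.getD t 0 ↔ t < l.countP (b ≤ ·) := by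
  induction l generalizing t with
  | nil => simp; omega
  | cons x l ih =>
    rw [List.pairwise_cons] at hl
    by_cases hx : b ≤ x
    · cases t with
      | zero => simp [hx]
      | succ t => simpa [hx] using ih hl.2 t
    · have h0 : l.countP (b ≤ ·) = 0 := by
        rw [List.countP_eq_zero]
        intro a ha
        have := hl.1 a ha
        simp only [decide_eq_true_eq]
        omega
      cases t with
      | zero => simp [hx, h0]
      | succ t =>
        have := ih hl.2 t
        simp only [h0, not_lt_zero, iff_false, not_le] at this
        simpa [hx, h0] using this

theorem le_part_iff {n : ℕ} (p : n.Partition) {b : ℕ} (hb : 1 ≤ b) (t : ℕ) :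
    b ≤ part p t ↔ t < numGE p.parts b := by
  have h := le_getD_iff_lt_countP (p.parts.pairwise_sort (· ≥ ·)) hb t
  rw [part, sortedParts, h, numGE]
  conv_rhs => rw [← p.parts.sort_eq (· ≥ ·)]
  rw [Multiset.coe_countP]

/-- Admissibility of a multiset of parts, expressed through multiplicities: a window of `d + 1`
consecutive parts that differ by at most `1` consists of copies of `a` and `a + 1` for some `a`. -/
structure IsAdmissibleMultiset (k J i : ℕ) (s : Multiset ℕ) : Prop where
  smallest : ∀ a ∈ s, J + 1 ≤ a
  multiplicity : s.count (J + 1) ≤ k - i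
  adjacent : ∀ a, J + 1 ≤ a → s.count a + s.count (a + 1) ≤ k - 1
  parity : ∀ a, J + 1 ≤ a → s.count a + s.count (a + 1) = k - 1 →
    a * s.count a + (a + 1) * s.count (a + 1) ≡ (k - 1) * J + i + k [MOD 2]

/-- The sum over a window that consists of all the parts equal to `a` or `a + 1`. -/
theorem sum_part_window {n : ℕ} (p : n.Partition) {a : ℕ} (ha : 1 ≤ a) :
    ∑ s ∈ Finset.range (p.parts.count a + p.parts.count (a + 1)),
      part p (numGE p.parts (a + 2) + s) =
    a * p.parts.count a + (a + 1) * p.parts.count (a + 1) := by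
  have h0 := numGE_eq_add_count p.parts a
  have h1 : _ = numGE p.parts (a + 2) + _ := numGE_eq_add_count p.parts (a + 1)
  rw [add_comm (p.parts.count a), Finset.sum_range_add, add_comm (a * _)]
  congr 1
  · rw [Finset.sum_congr rfl (g := fun _ => a + 1)]
    · simp [mul_comm]
    · intro s hs
      rw [Finset.mem_range] at hs
      have e1 := (le_part_iff p (show 1 ≤ a + 1 by omega) (numGE p.parts (a + 2) + s)).2 (by omega)
      have e2 := (le_part_iff p (show 1 ≤ a + 2 by omega) (numGE p.parts (a + 2) + s)).not.2
        (by omega)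
      omega
  · rw [Finset.sum_congr rfl (g := fun _ => a)]
    · simp [mul_comm]
    · intro s hs
      rw [Finset.mem_range] at hs
      have e1 := (le_part_iff p ha
        (numGE p.parts (a + 2) + (p.parts.count (a + 1) + s))).2 (by omega)
      have e2 := (le_part_iff p (show 1 ≤ a + 1 by omega)
        (numGE p.parts (a + 2) + (p.parts.count (a + 1) + s))).not.2 (by omega)
      omega

theorem isAdmissible_iff {k J i : ℕ} (hk : 2 ≤ k) {n : ℕ} (p : n.Partition) :
    IsAdmissible k J i p ↔ IsAdmissibleMultiset k J i p.parts := by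
  have hcard : numGE p.parts 1 = p.parts.card :=
    numGE_eq_card fun a ha => p.parts_pos ha
  constructor
  · intro h
    have hadj : ∀ a, J + 1 ≤ a → p.parts.count a + p.parts.count (a + 1) ≤ k - 1 := by
      intro a ha
      by_contra! hlt
      have h0 := numGE_eq_add_count p.parts a
      have h1 : _ = numGE p.parts (a + 2) + _ := numGE_eq_add_count p.parts (a + 1)
      have e1 := (le_part_iff p (show 1 ≤ a by omega)
        (numGE p.parts (a + 2) + (k - 1))).2 (by omega)
      have e2 := (le_part_iff p (show 1 ≤ a + 2 by omega) (numGE p.parts (a + 2))).not.2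
        (by omega)
      have := h.difference (numGE p.parts (a + 2))
        (by have := numGE_le_card p.parts a; omega)
      omega
    refine ⟨h.smallest, h.multiplicity, hadj, fun a ha heq => ?_⟩
    have h0 := numGE_eq_add_count p.parts a
    have h1 : _ = numGE p.parts (a + 2) + _ := numGE_eq_add_count p.parts (a + 1)
    rw [← sum_part_window p (show 1 ≤ a by omega), heq]
    refine h.parity _ (by have := numGE_le_card p.parts a; omega) ?_
    have e1 := (le_part_iff p (show 1 ≤ a by omega)
      (numGE p.parts (a + 2) + (k - 2))).2 (by omega)
    have e2 := (le_part_iff p (show 1 ≤ a + 2 by omega) (numGE p.parts (a + 2))).not.2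
      (by omega)
    omega
  · intro h
    have hcard' := numGE_eq_card h.smallest
    refine ⟨fun t ht => ?_, h.smallest, h.multiplicity, fun t ht hle => ?_⟩
    · set a := part p (t + (k - 1)) with hadef
      have ha : J + 1 ≤ a := (le_part_iff p (by omega) _).2 (by omega)
      have h0 := numGE_eq_add_count p.parts a
      have h1 : _ = numGE p.parts (a + 2) + _ := numGE_eq_add_count p.parts (a + 1)
      have e1 := (le_part_iff p (show 1 ≤ a by omega) (t + (k - 1))).1 le_rfl
      have := h.adjacent a ha
      exact (le_part_iff p (by omega) _).2 (by omega)
    · -- The window consists of all the parts equal to `a` or `a + 1`.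
      set a := part p (t + (k - 2)) with hadef
      have ha : J + 1 ≤ a := (le_part_iff p (by omega) _).2 (by omega)
      have h0 := numGE_eq_add_count p.parts a
      have h1 : _ = numGE p.parts (a + 2) + _ := numGE_eq_add_count p.parts (a + 1)
      have e1 := (le_part_iff p (show 1 ≤ a by omega) (t + (k - 2))).1 le_rfl
      have e2 := (le_part_iff p (show 1 ≤ a + 2 by omega) t).not.1 (by omega)
      have h2 := h.adjacent a ha
      have heq : p.parts.count a + p.parts.count (a + 1) = k - 1 := by omega
      have ht' : t = numGE p.parts (a + 2) := by omega
      have := h.parity a ha heq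
      rwa [← sum_part_window p (show 1 ≤ a by omega), heq, ← ht'] at this

/-! ### Generating functions of classes of partitions -/

open Classical in
/-- The generating function of the partitions whose multiset of parts satisfies `P`. -/
noncomputable def partitionGF (P : Multiset ℕ → Prop) : ℂ⟦X⟧ :=
  PowerSeries.mk fun n => ((Finset.univ.filter fun p : n.Partition => P p.parts).card : ℂ)

theorem partitionGF_congr {P Q : Multiset ℕ → Prop} (h : ∀ s, P s ↔ Q s) :
    partitionGF P = partitionGF Q := by
  rw [funext fun s => propext (h s)]

theorem partitionGF_or {P Q : Multiset ℕ → Prop} (h : ∀ s, P s → ¬ Q s) :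
    partitionGF (fun s => P s ∨ Q s) = partitionGF P + partitionGF Q := by
  classical
  ext n
  simp only [partitionGF, PowerSeries.coeff_mk, map_add]
  rw [Finset.filter_or, Finset.card_union_of_disjoint, Nat.cast_add]
  exact Finset.disjoint_filter.2 fun p _ hp => h _ hp

/-- Prescribing `c` copies of the part `a` multiplies the generating function by `q^{ca}`. -/
theorem partitionGF_replicate_add {P Q : Multiset ℕ → Prop} {a : ℕ} (ha : 0 < a) (c : ℕ)
    (hP : ∀ s, P s → c ≤ s.count a) (h : ∀ t, P (Multiset.replicate c a + t) ↔ Q t) :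
    partitionGF P = PowerSeries.X ^ (a * c) * partitionGF Q := by
  classical
  ext n
  rw [PowerSeries.coeff_X_pow_mul']
  simp only [partitionGF, PowerSeries.coeff_mk]
  have hsplit : ∀ s, P s → Multiset.replicate c a + (s - Multiset.replicate c a) = s := fun s hs =>
    add_tsub_cancel_of_le (Multiset.le_count_iff_replicate_le.1 (hP s hs))
  split_ifs with hn
  · congr 1
    refine Finset.card_bij'
      (fun p hp => ⟨p.parts - Multiset.replicate c a,
        fun hx => p.parts_pos (Multiset.mem_of_le (Multiset.sub_le_self _ _) hx), ?_⟩)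
      (fun p hp => ⟨Multiset.replicate c a + p.parts, ?_, ?_⟩) ?_ ?_ ?_ ?_
    · have h1 := congrArg Multiset.sum (hsplit _ (Finset.mem_filter.1 hp).2)
      rw [Multiset.sum_add, p.parts_sum, Multiset.sum_replicate, smul_eq_mul, mul_comm] at h1
      omega
    · intro x hx
      rcases Multiset.mem_add.1 hx with hx | hx
      · rwa [Multiset.eq_of_mem_replicate hx]
      · exact p.parts_pos hx
    · rw [Multiset.sum_add, p.parts_sum, Multiset.sum_replicate, smul_eq_mul, mul_comm]
      omega
    · intro p hp
      have hp := (Finset.mem_filter.1 hp).2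
      refine Finset.mem_filter.2 ⟨Finset.mem_univ _, ?_⟩
      rw [← h, hsplit _ hp]
      exact hp
    · intro p hp
      exact Finset.mem_filter.2 ⟨Finset.mem_univ _, (h _).2 (Finset.mem_filter.1 hp).2⟩
    · intro p hp
      exact Nat.Partition.ext (hsplit _ (Finset.mem_filter.1 hp).2)
    · intro p hp
      exact Nat.Partition.ext (by simp)
  · rw [Nat.cast_eq_zero, Finset.card_eq_zero, Finset.filter_eq_empty_iff]
    intro p _ hp
    have h1 := congrArg Multiset.sum (hsplit _ hp)
    rw [Multiset.sum_add, p.parts_sum, Multiset.sum_replicate, smul_eq_mul, mul_comm] at h1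
    omega

/-- The generating function of the admissible partitions. -/
noncomputable def admissibleGF (k J i : ℕ) : ℂ⟦X⟧ := partitionGF (IsAdmissibleMultiset k J i)

theorem admissibleGF_eq {k : ℕ} (hk : 2 ≤ k) (J i : ℕ) :
    admissibleGF k J i = PowerSeries.mk fun n => (admissibleCount k J i n : ℂ) := by
  ext n
  simp only [admissibleGF, partitionGF, PowerSeries.coeff_mk, admissibleCount]
  congr 2
  ext p
  simp only [Finset.mem_filter, isAdmissible_iff hk]

/-- Removing the parts `J + 1`: the parity condition in the window formed by the parts `J + 1`
and `J + 2` sharpens the bound on the multiplicity of `J + 2` when there are `i - 2` parts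
`J + 1`, so that the same class results as for `i - 1` parts. -/
theorem isAdmissibleMultiset_replicate_add_iff {k J i c : ℕ} (hi : 1 ≤ i) (hik : i ≤ k)
    (hc : c + 1 = i ∨ c + 2 = i) (t : Multiset ℕ) :
    (IsAdmissibleMultiset k J (k - i + 1) (Multiset.replicate c (J + 1) + t) ∧
      (Multiset.replicate c (J + 1) + t).count (J + 1) = c) ↔
    IsAdmissibleMultiset k (J + 1) i t := by
  obtain ⟨m, rfl⟩ : ∃ m, k = m + i := ⟨k - i, by omega⟩
  have hcount : ∀ a, J + 1 + 1 ≤ a → (Multiset.replicate c (J + 1) + t).count a = t.count a := by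
    intro a ha
    rw [Multiset.count_add, Multiset.count_replicate, if_neg (by omega), zero_add]
  have hcount' : (Multiset.replicate c (J + 1) + t).count (J + 1) = c + t.count (J + 1) := by
    rw [Multiset.count_add, Multiset.count_replicate_self]
  have hpar : ∀ x : ℕ, x ≡ (m + i - 1) * J + (m + i - i + 1) + (m + i) [MOD 2] ↔
      x ≡ (m + i - 1) * (J + 1) + i + (m + i) [MOD 2] := by
    intro x
    simp only [Nat.ModEq, mul_add]
    omega
  constructor
  · rintro ⟨h, h0⟩
    have h0 : t.count (J + 1) = 0 := by omega
    refine ⟨fun a ha => ?_, ?_, fun a ha => ?_, fun a ha => ?_⟩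
    · have h1 := h.smallest a (Multiset.mem_add.2 (Or.inr ha))
      have h2 : a ≠ J + 1 := by
        rintro rfl
        exact Multiset.count_ne_zero.2 ha h0
      omega
    · -- With `i - 2` parts `J + 1`, equality in the bound `h1` would violate the parity condition.
      have h1 := h.adjacent (J + 1) le_rfl
      have h2 := h.parity (J + 1) le_rfl
      rw [hcount', hcount _ le_rfl, h0] at h1 h2
      rcases hc with rfl | rfl
      · omega
      · by_contra! h3
        have h4 : t.count (J + 1 + 1) = m + 1 := by omega
        rw [h4] at h2
        have h5 := h2 (by omega)
        rw [show m + (c + 2) - 1 = m + c + 1 by omega] at h5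
        simp only [Nat.ModEq, mul_add, add_mul] at h5
        ring_nf at h5
        omega
    · have := h.adjacent a (by omega)
      rwa [hcount _ (by omega), hcount _ (by omega)] at this
    · have := h.parity a (by omega)
      rw [hcount _ (by omega), hcount _ (by omega)] at this
      exact fun he => (hpar _).1 (this he)
  · intro h
    have h0 : t.count (J + 1) = 0 := by
      rw [Multiset.count_eq_zero]
      intro ha
      have := h.smallest _ ha
      omega
    have hm := h.multiplicity
    refine ⟨⟨fun a ha => ?_, by omega, fun a ha => ?_, fun a ha => ?_⟩, by omega⟩
    · rcases Multiset.mem_add.1 ha with ha | ha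
      · exact (Multiset.eq_of_mem_replicate ha).ge
      · have := h.smallest a ha
        omega
    · rcases ha.eq_or_lt with rfl | ha
      · rw [hcount', hcount _ le_rfl]
        omega
      · rw [hcount _ (by omega), hcount _ (by omega)]
        exact h.adjacent a ha
    · rcases ha.eq_or_lt with rfl | ha
      · rw [hcount', hcount _ le_rfl, h0]
        intro h1
        obtain ⟨h2, rfl⟩ : t.count (J + 1 + 1) = m ∧ c + 1 = i := by omega
        rw [h2, show m + (c + 1) - 1 = m + c by omega, show m + (c + 1) - (c + 1) = m by omega]
        simp only [Nat.ModEq]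
        ring_nf
        omega
      · rw [hcount _ (by omega), hcount _ (by omega)]
        exact fun he => (hpar _).2 (h.parity a ha he)

theorem partitionGF_count_eq {k J i c : ℕ} (hi : 1 ≤ i) (hik : i ≤ k)
    (hc : c + 1 = i ∨ c + 2 = i) :
    partitionGF (fun s => IsAdmissibleMultiset k J (k - i + 1) s ∧ s.count (J + 1) = c) =
      PowerSeries.X ^ ((J + 1) * c) * admissibleGF k (J + 1) i :=
  partitionGF_replicate_add J.succ_pos c (fun _ hs => hs.2.ge)
    (isAdmissibleMultiset_replicate_add_iff hi hik hc)

theorem admissibleGF_succ_one {k : ℕ} (hk : 2 ≤ k) (J : ℕ) :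
    admissibleGF k (J + 1) 1 = admissibleGF k J k := by
  have h := partitionGF_count_eq (k := k) (J := J) (i := 1) (c := 0) le_rfl (by omega) (Or.inl rfl)
  rw [mul_zero, pow_zero, one_mul, show k - 1 + 1 = k by omega] at h
  rw [← h, admissibleGF]
  refine partitionGF_congr fun s => ⟨fun hs => hs.1, fun hs => ⟨hs, ?_⟩⟩
  have := hs.multiplicity
  omega

theorem admissibleGF_sub_one {k : ℕ} (hk : 2 ≤ k) (J : ℕ) :
    admissibleGF k J (k - 1) = (1 + PowerSeries.X ^ (J + 1)) * admissibleGF k (J + 1) 2 := by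
  have h0 := partitionGF_count_eq (k := k) (J := J) (i := 2) (c := 0) (by omega) hk (Or.inr rfl)
  have h1 := partitionGF_count_eq (k := k) (J := J) (i := 2) (c := 1) (by omega) hk (Or.inl rfl)
  rw [show k - 2 + 1 = k - 1 by omega] at h0 h1
  rw [mul_zero, pow_zero] at h0
  rw [mul_one] at h1
  rw [add_mul, ← h0, ← h1, ← partitionGF_or (fun s hs hs' => by omega), admissibleGF]
  refine partitionGF_congr fun s => ⟨fun hs => ?_, fun hs => hs.elim And.left And.left⟩
  have := hs.multiplicity
  rw [← and_or_left]
  exact ⟨hs, by omega⟩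

theorem admissibleGF_sub {k i : ℕ} (hi : 3 ≤ i) (hik : i ≤ k) (J : ℕ) :
    admissibleGF k J (k - i + 1) = admissibleGF k J (k - i + 3) +
      PowerSeries.X ^ ((J + 1) * (i - 2)) * (1 + PowerSeries.X ^ (J + 1)) *
        admissibleGF k (J + 1) i := by
  have h0 := partitionGF_count_eq (k := k) (J := J) (i := i) (c := i - 2) (by omega) hik (by omega)
  have h1 := partitionGF_count_eq (k := k) (J := J) (i := i) (c := i - 1) (by omega) hik (by omega)
  rw [mul_add, mul_one, ← pow_add, ← Nat.mul_succ, show (i - 2).succ = i - 1 by omega, add_mul,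
    ← h0, ← h1, ← partitionGF_or (fun s hs hs' => by omega), admissibleGF, admissibleGF,
    ← partitionGF_or]
  · refine partitionGF_congr fun s => ?_
    rw [← and_or_left]
    -- The two indices `k - i + 1` and `k - i + 3` impose the same parity.
    have hpar : (k - 1) * J + (k - i + 3) + k = (k - 1) * J + (k - i + 1) + k + 2 := by ring
    have hpar' : ∀ x : ℕ, x ≡ (k - 1) * J + (k - i + 3) + k [MOD 2] ↔
        x ≡ (k - 1) * J + (k - i + 1) + k [MOD 2] := by
      intro x
      rw [hpar]
      simp [Nat.ModEq]
    constructor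
    · intro hs
      by_cases hc : s.count (J + 1) ≤ k - (k - i + 3)
      · exact Or.inl ⟨hs.smallest, hc, hs.adjacent, fun a ha he => (hpar' _).2 (hs.parity a ha he)⟩
      · have := hs.multiplicity
        exact Or.inr ⟨hs, by omega⟩
    · rintro (hs | hs)
      · have := hs.multiplicity
        exact ⟨hs.smallest, by omega, hs.adjacent, fun a ha he => (hpar' _).1 (hs.parity a ha he)⟩
      · exact hs.1
  · intro s hs hs'
    have := hs.multiplicity
    omega

/-- A nonempty partition with all parts at least `J + 1` has size at least `J + 1`. -/
theorem X_pow_dvd_admissibleGF_sub_one {k : ℕ} (hk : 2 ≤ k) (J i : ℕ) :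
    PowerSeries.X ^ (J + 1) ∣ admissibleGF k J i - 1 := by
  classical
  rw [PowerSeries.X_pow_dvd_iff]
  intro n hn
  rw [map_sub, PowerSeries.coeff_one, admissibleGF, partitionGF, PowerSeries.coeff_mk]
  split_ifs with h0
  · subst h0
    rw [Finset.filter_true_of_mem]
    · simp
    · intro p _
      rw [Nat.Partition.partition_zero_parts]
      refine ⟨by simp, by simp, by simp, fun a _ h => ?_⟩
      simp only [Multiset.count_zero] at h
      omega
  · rw [sub_zero, Nat.cast_eq_zero, Finset.card_eq_zero, Finset.filter_eq_empty_iff]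
    intro p _ hp
    obtain ⟨a, ha⟩ : ∃ a, a ∈ p.parts := Multiset.exists_mem_of_ne_zero fun h => h0 <| by
      rw [← p.parts_sum, h, Multiset.sum_zero]
    have := hp.smallest a ha
    have := p.le_of_mem_parts ha
    omega

/-! ### Congruences and limits of power series -/

section Congruences

open PowerSeries Filter Topology
open scoped PowerSeries.WithPiTopology

theorem dvd_mul_sub_one {R : Type*} [CommRing R] {d x y : R} (hx : d ∣ x - 1) (hy : d ∣ y - 1) :
    d ∣ x * y - 1 := by
  rw [show x * y - 1 = (x - 1) * y + (y - 1) by ring]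
  exact dvd_add (hx.mul_right y) hy

theorem dvd_prod_sub_one {R ι : Type*} [CommRing R] {d : R} (s : Finset ι) {f : ι → R}
    (h : ∀ a ∈ s, d ∣ f a - 1) : d ∣ ∏ a ∈ s, f a - 1 :=
  Finset.prod_induction f (fun x => d ∣ x - 1) (fun _ _ => dvd_mul_sub_one) (by simp) h

theorem X_pow_dvd_one_sub_X_pow_sub_one {m n : ℕ} (h : m ≤ n) :
    (X : ℂ⟦X⟧) ^ m ∣ 1 - X ^ n - 1 := by
  rw [sub_sub_cancel_left, dvd_neg]
  exact pow_dvd_pow X h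

theorem X_pow_dvd_sub_of_tendsto {F : ℕ → ℂ⟦X⟧} {f g : ℂ⟦X⟧} (hF : Tendsto F atTop (𝓝 f))
    (M N : ℕ) (h : ∀ n, N ≤ n → X ^ M ∣ F n - g) : X ^ M ∣ f - g := by
  rw [X_pow_dvd_iff]
  intro m hm
  rw [map_sub, sub_eq_zero]
  have h1 : Tendsto (fun n => coeff m (F n)) atTop (𝓝 (coeff m f)) :=
    ((WithPiTopology.continuous_coeff ℂ m).tendsto f).comp hF
  refine tendsto_nhds_unique h1 (tendsto_nhds_of_eventually_eq ?_)
  filter_upwards [eventually_ge_atTop N] with n hn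
  have := X_pow_dvd_iff.1 (h n hn) m hm
  rwa [map_sub, sub_eq_zero] at this

theorem eq_of_tendsto_of_X_pow_dvd {F G : ℕ → ℂ⟦X⟧} {f g : ℂ⟦X⟧} (hF : Tendsto F atTop (𝓝 f))
    (hG : Tendsto G atTop (𝓝 g)) (h : ∀ n, X ^ n ∣ F n - G n) : f = g := by
  refine tendsto_nhds_unique hF ?_
  rw [WithPiTopology.tendsto_iff_coeff_tendsto] at hG ⊢
  intro m
  refine (hG m).congr' ?_
  filter_upwards [eventually_gt_atTop m] with n hn
  have := X_pow_dvd_iff.1 (h n) m hn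
  rw [map_sub, sub_eq_zero] at this
  exact this.symm

theorem summable_of_X_pow_dvd {f : ℕ → ℂ⟦X⟧} (h : ∀ n, X ^ n ∣ f n) : Summable f := by
  apply WithPiTopology.summable_of_tendsto_order_atTop_nhds_top
  rw [ENat.tendsto_nhds_top_iff_natCast_lt]
  intro n
  filter_upwards [eventually_gt_atTop n] with m hm
  exact lt_of_lt_of_le (Nat.cast_lt.2 hm) (nat_le_order _ _ (X_pow_dvd_iff.1 (h m)))

theorem X_pow_dvd_tsum_sub_zero {f : ℕ → ℂ⟦X⟧} (hf : Summable f) {M : ℕ}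
    (h : ∀ n, 1 ≤ n → X ^ M ∣ f n) : X ^ M ∣ ∑' n, f n - f 0 := by
  refine X_pow_dvd_sub_of_tendsto hf.hasSum.tendsto_sum_nat M 1 fun n hn => ?_
  obtain ⟨n, rfl⟩ : ∃ m, n = m + 1 := ⟨n - 1, by omega⟩
  rw [Finset.sum_range_succ', add_sub_cancel_right]
  exact Finset.dvd_sum fun m _ => h _ (by omega)

/-- If `f n = A n + B n` and `g n = A (n + 1) + B n` with `A 0 = 0`, then `f` and `g` have the
same sum. -/
theorem tsum_eq_tsum_of_shift {f g A B : ℕ → ℂ⟦X⟧} (hA : Summable A) (hB : Summable B)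
    (h0 : A 0 = 0) (hf : ∀ n, f n = A n + B n) (hg : ∀ n, g n = A (n + 1) + B n) :
    ∑' n, f n = ∑' n, g n := by
  have hA' : Summable fun n => A (n + 1) := hA.comp_injective (add_left_injective 1)
  rw [tsum_congr hf, tsum_congr hg, hA.tsum_add hB, hA'.tsum_add hB, hA.tsum_eq_zero_add, h0,
    zero_add]

end Congruences

/-! ### The series of the shelves -/

section ShelfSum

open PowerSeries Filter Topology
open scoped PowerSeries.WithPiTopology

/-- The product `∏_{s = 1}^{j} (1 - q^{2(n+s)})`. -/
noncomputable def evenProd (j n : ℕ) : ℂ⟦X⟧ :=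
  ∏ s ∈ Finset.range j, (1 - X ^ (2 * (n + (s + 1))))

theorem evenProd_succ_left (j n : ℕ) :
    evenProd (j + 1) n = evenProd j n * (1 - X ^ (2 * (n + (j + 1)))) :=
  Finset.prod_range_succ _ _

theorem evenProd_shift (j n : ℕ) :
    evenProd j (n + 1) * (1 - X ^ (2 * (n + 1))) = evenProd (j + 1) n := by
  rw [evenProd, evenProd, Finset.prod_range_succ', zero_add]
  congr 1
  exact Finset.prod_congr rfl fun s _ => by rw [show n + 1 + (s + 1) = n + (s + 1 + 1) by ring]

/-- The summands of the alternating series that represents the `i`-th official series on the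
shelf `j`. -/
noncomputable def shelfTerm (k j i n : ℕ) : ℂ⟦X⟧ :=
  (-1) ^ n * X ^ (k * n ^ 2 + ((k - 1) * j + (i - 1)) * n) * evenProd j n *
    (1 - X ^ ((k + 1 - i) * (2 * n + 1 + j)))

/-- The numerator of the `i`-th official series on the shelf `j`; the denominator is
`shelfDenom j`. At `i = k + 1`, one step beyond the shelf, it vanishes. -/
noncomputable def shelfSum (k j i : ℕ) : ℂ⟦X⟧ := ∑' n, shelfTerm k j i n

/-- The product `(q)_∞ (1 + q) ⋯ (1 + q^j)`. -/
noncomputable def shelfDenom (j : ℕ) : ℂ⟦X⟧ := qInf * ∏ s ∈ Finset.range j, (1 + X ^ (s + 1))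

theorem X_pow_dvd_pow_sq {k : ℕ} (hk : 1 ≤ k) (e n : ℕ) :
    (X : ℂ⟦X⟧) ^ n ∣ X ^ (k * n ^ 2 + e * n) := by
  refine pow_dvd_pow X ?_
  nlinarith [Nat.le_self_pow (n := 2) (by norm_num) n, Nat.zero_le (e * n),
    Nat.mul_le_mul hk (Nat.le_refl (n ^ 2))]

theorem summable_shelfTerm {k : ℕ} (hk : 1 ≤ k) (j i : ℕ) : Summable (shelfTerm k j i) :=
  summable_of_X_pow_dvd fun n =>
    (((X_pow_dvd_pow_sq hk _ n).mul_left _).mul_right _).mul_right _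

theorem shelfSum_last (k j : ℕ) : shelfSum k j (k + 1) = 0 := by
  simp [shelfSum, shelfTerm]

/-- The alternating series satisfy the recursion of the official series: the difference splits
into two series, and an index shift in the first one makes the common factor appear. -/
theorem shelfSum_sub {k i : ℕ} (hi : 2 ≤ i) (hik : i ≤ k) (j : ℕ) :
    shelfSum k j (k - i + 1) - shelfSum k j (k - i + 3) =
      X ^ ((j + 1) * (i - 2)) * shelfSum k (j + 1) i := by
  obtain ⟨i, rfl⟩ : ∃ i', i = i' + 2 := ⟨i - 2, by omega⟩
  obtain ⟨m, rfl⟩ : ∃ m, k = m + (i + 2) := ⟨k - (i + 2), by omega⟩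
  rw [Nat.add_sub_cancel, Nat.add_sub_cancel, shelfSum, shelfSum, shelfSum,
    ← (summable_shelfTerm (by omega) _ _).tsum_sub (summable_shelfTerm (by omega) _ _),
    ← (summable_shelfTerm (by omega) _ _).tsum_mul_left]
  have e1 : m + (i + 2) - 1 = m + i + 1 := by omega
  have e2 : m + (i + 2) + 1 - (m + 1) = i + 2 := by omega
  have e3 : m + (i + 2) + 1 - (m + 3) = i := by omega
  have e4 : m + (i + 2) + 1 - (i + 2) = m + 1 := by omega
  have e5 : m + 3 - 1 = m + 2 := by omega
  have e6 : i + 2 - 1 = i + 1 := by omega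
  refine tsum_eq_tsum_of_shift
    (A := fun n => (-1) ^ n * X ^ ((m + (i + 2)) * n ^ 2 + ((m + i + 1) * j + m) * n) *
      evenProd j n * (1 - X ^ (2 * n)))
    (B := fun n => (-1) ^ n * X ^ ((m + (i + 2)) * n ^ 2 + ((m + i + 1) * j + m) * n) *
      evenProd j n * (X ^ (i * (2 * n + 1 + j) + 2 * n) * (1 - X ^ (2 * (n + (j + 1))))))
    (summable_of_X_pow_dvd fun n =>
      (((X_pow_dvd_pow_sq (by omega) _ n).mul_left _).mul_right _).mul_right _)
    (summable_of_X_pow_dvd fun n =>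
      (((X_pow_dvd_pow_sq (by omega) _ n).mul_left _).mul_right _).mul_right _)
    (by simp) (fun n => ?_) fun n => ?_
  · simp only [shelfTerm, e1, e2, e3, e5, Nat.add_sub_cancel]
    ring
  · simp only [shelfTerm, e1, e4, e6]
    rw [mul_assoc _ (evenProd j (n + 1)), evenProd_shift, evenProd_succ_left]
    ring

/-- The last series of a shelf and the first series of the next one agree up to the change of
denominators. -/
theorem shelfSum_succ_one {k : ℕ} (hk : 1 ≤ k) (j : ℕ) :
    (1 + X ^ (j + 1)) * shelfSum k j k = shelfSum k (j + 1) 1 := by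
  obtain ⟨k, rfl⟩ : ∃ k', k = k' + 1 := ⟨k - 1, by omega⟩
  rw [shelfSum, shelfSum, ← (summable_shelfTerm hk _ _).tsum_mul_left]
  have e1 : k + 1 + 1 - (k + 1) = 1 := by omega
  refine tsum_eq_tsum_of_shift
    (A := fun n => (-1) ^ n * X ^ ((k + 1) * n ^ 2 + (k * (j + 1)) * n) *
      evenProd j n * (X ^ (j + 1) * (1 - X ^ (2 * n))))
    (B := fun n => (-1) ^ n * X ^ ((k + 1) * n ^ 2 + (k * (j + 1)) * n) *
      evenProd j n * (1 - X ^ (2 * (n + (j + 1)))))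
    (summable_of_X_pow_dvd fun n =>
      (((X_pow_dvd_pow_sq (by omega) _ n).mul_left _).mul_right _).mul_right _)
    (summable_of_X_pow_dvd fun n =>
      (((X_pow_dvd_pow_sq (by omega) _ n).mul_left _).mul_right _).mul_right _)
    (by simp) (fun n => ?_) fun n => ?_
  · simp only [shelfTerm, e1, Nat.add_sub_cancel]
    ring
  · simp only [shelfTerm, Nat.add_sub_cancel, Nat.sub_self, add_zero]
    rw [mul_assoc _ (evenProd j (n + 1)), mul_left_comm (evenProd j (n + 1)), evenProd_shift,
      evenProd_succ_left]
    ring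

theorem shelfDenom_succ (j : ℕ) :
    shelfDenom (j + 1) = shelfDenom j * (1 + X ^ (j + 1)) := by
  rw [shelfDenom, Finset.prod_range_succ, ← mul_assoc, shelfDenom]

/-- `(q^2; q^2)_j` is congruent to `(q)_∞ (1 + q) ⋯ (1 + q^j)` modulo `q^j`. -/
theorem X_pow_dvd_evenProd_sub_shelfDenom (j : ℕ) :
    X ^ j ∣ evenProd j 0 - shelfDenom j := by
  have h1 : X ^ j ∣ qInf - ∏ s ∈ Finset.range j, (1 - X ^ (s + 1)) := by
    refine X_pow_dvd_sub_of_tendsto multipliable_qInf.hasProd.tendsto_prod_nat j j fun n hn => ?_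
    obtain ⟨d, rfl⟩ := Nat.exists_eq_add_of_le hn
    rw [Finset.prod_range_add, ← mul_sub_one]
    exact (dvd_prod_sub_one _ fun a _ =>
      X_pow_dvd_one_sub_X_pow_sub_one (by omega)).mul_left _
  have h2 : evenProd j 0 = (∏ s ∈ Finset.range j, (1 - X ^ (s + 1))) *
      ∏ s ∈ Finset.range j, (1 + X ^ (s + 1)) := by
    rw [evenProd, ← Finset.prod_mul_distrib]
    refine Finset.prod_congr rfl fun s _ => ?_
    ring
  rw [h2, shelfDenom, ← sub_mul, ← dvd_neg, ← neg_mul, neg_sub]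
  exact h1.mul_right _

theorem X_pow_dvd_shelfSum_sub_shelfDenom {k i : ℕ} (hk : 2 ≤ k) (hik : i ≤ k) (j : ℕ) :
    X ^ j ∣ shelfSum k j i - shelfDenom j := by
  have h1 : X ^ j ∣ shelfSum k j i - shelfTerm k j i 0 := by
    refine X_pow_dvd_tsum_sub_zero (summable_shelfTerm (by omega) j i) fun n hn => ?_
    refine (((pow_dvd_pow X ?_).mul_left _).mul_right _).mul_right _
    have : 1 * j * 1 ≤ (k - 1) * j * n := by gcongr; omega
    nlinarith [Nat.zero_le (k * n ^ 2), Nat.zero_le ((i - 1) * n)]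
  have h2 : X ^ j ∣ shelfTerm k j i 0 - evenProd j 0 := by
    rw [shelfTerm]
    simp only [pow_zero, mul_zero, zero_add, one_mul, ne_eq, OfNat.ofNat_ne_zero,
      not_false_eq_true, zero_pow]
    rw [← mul_sub_one]
    refine (X_pow_dvd_one_sub_X_pow_sub_one ?_).mul_left _
    have : 1 * (1 + j) ≤ (k + 1 - i) * (1 + j) := by gcongr; omega
    omega
  have := dvd_add (dvd_add h1 h2) (X_pow_dvd_evenProd_sub_shelfDenom j)
  rwa [sub_add_sub_cancel, sub_add_sub_cancel] at this

end ShelfSum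

/-! ### Uniqueness of the solution of the recursion -/

open PowerSeries in
/-- Both sides satisfy the same recursion and are congruent modulo `q^j` on the shelf `j`.
The recursion expresses a shelf through the next one, so the congruence modulo `q^n` on the shelf
`n` descends to all earlier shelves. -/
theorem shelfSum_eq {k : ℕ} (hk : 2 ≤ k) {j i : ℕ} (hi : 1 ≤ i) (hik : i ≤ k) :
    shelfSum k j i = shelfDenom j * admissibleGF k j i := by
  have hunit : ∀ j, IsUnit (1 + X ^ (j + 1) : ℂ⟦X⟧) := fun j => by
    rw [PowerSeries.isUnit_iff_constantCoeff]
    simp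
  -- The outer induction is on the distance `d` to a shelf `≥ n`, the inner one on the distance `m`
  -- of `i` from the end `k` of the shelf, since the series at `i` depends on the one at `i + 2`.
  have key : ∀ n d j, n ≤ j + d → ∀ m i, k ≤ i + m → 1 ≤ i → i ≤ k →
      X ^ n ∣ shelfSum k j i - shelfDenom j * admissibleGF k j i := by
    intro n d
    induction d with
    | zero =>
      intro j hj m i _ _ hik
      refine (pow_dvd_pow X hj).trans ?_
      have h1 := X_pow_dvd_shelfSum_sub_shelfDenom hk hik j
      have h2 := (pow_dvd_pow X j.le_succ).trans (X_pow_dvd_admissibleGF_sub_one hk j i)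
      rw [show shelfSum k j i - shelfDenom j * admissibleGF k j i =
        (shelfSum k j i - shelfDenom j) - shelfDenom j * (admissibleGF k j i - 1) by ring]
      exact dvd_sub h1 (h2.mul_left _)
    | succ d ihd =>
      intro j hj m
      have ihd := ihd (j + 1) (by omega) k
      induction m using Nat.strong_induction_on with
      | _ m ihm =>
      intro i him hi hik
      rcases Nat.lt_or_ge i k with hlt | hge
      · have hs := shelfSum_sub (k := k) (i := k + 1 - i) (by omega) (by omega) j
        have hd := ihd (k + 1 - i) (by omega) (by omega) (by omega)
        rw [show k - (k + 1 - i) + 1 = i by omega, show k - (k + 1 - i) + 3 = i + 2 by omega] at hs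
        rcases Nat.lt_or_ge (i + 1) k with hlt' | hge'
        · have hG := admissibleGF_sub (k := k) (i := k + 1 - i) (by omega) (by omega) j
          rw [show k - (k + 1 - i) + 1 = i by omega,
            show k - (k + 1 - i) + 3 = i + 2 by omega] at hG
          have h2 := ihm (m - 2) (by omega) (i + 2) (by omega) (by omega) (by omega)
          rw [eq_add_of_sub_eq hs, hG]
          have := dvd_add h2 (hd.mul_left (X ^ ((j + 1) * (k + 1 - i - 2))))
          rw [shelfDenom_succ] at this
          convert this using 1
          ring
        · obtain rfl : i = k - 1 := by omega
          rw [show k - 1 + 2 = k + 1 by omega, shelfSum_last, sub_zero,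
            show k + 1 - (k - 1) = 2 by omega, Nat.sub_self, mul_zero, pow_zero, one_mul] at hs
          rw [show k + 1 - (k - 1) = 2 by omega, shelfDenom_succ] at hd
          rw [hs, admissibleGF_sub_one hk, ← mul_assoc]
          exact hd
      · obtain rfl : i = k := by omega
        have hd := ihd 1 (by omega) le_rfl (by omega)
        rw [← shelfSum_succ_one (by omega), shelfDenom_succ, admissibleGF_succ_one hk,
          mul_comm (shelfDenom j), mul_assoc, ← mul_sub] at hd
        exact (hunit j).dvd_mul_left.1 hd
  rw [← sub_eq_zero]
  ext n
  exact X_pow_dvd_iff.1 (key (n + 1) (n + 1) j (by omega) k i (by omega) hi hik) n (by omega)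

/-! ### Gaussian binomial coefficients -/

section GaussBinom

variable {R : Type*} [CommRing R]

/-- The Gaussian binomial coefficient with base `Q`, defined by the `Q`-Pascal recursion. -/
def gaussBinom (Q : R) : ℕ → ℕ → R
  | _, 0 => 1
  | 0, _ + 1 => 0
  | N + 1, r + 1 => gaussBinom Q N r + Q ^ (r + 1) * gaussBinom Q N (r + 1)

@[simp] theorem gaussBinom_zero_right (Q : R) (N : ℕ) : gaussBinom Q N 0 = 1 := by
  cases N <;> rfl

theorem gaussBinom_eq_zero (Q : R) {N r : ℕ} (h : N < r) : gaussBinom Q N r = 0 := by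
  induction N generalizing r with
  | zero =>
    obtain ⟨r, rfl⟩ : ∃ r', r = r' + 1 := ⟨r - 1, by omega⟩
    rfl
  | succ N ih =>
    obtain ⟨r, rfl⟩ : ∃ r', r = r' + 1 := ⟨r - 1, by omega⟩
    rw [gaussBinom, ih (by omega), ih (by omega), mul_zero, add_zero]

/-- The `Q`-binomial theorem, in homogeneous form. -/
theorem prod_add_mul_pow (Q a b : R) (N : ℕ) :
    ∏ t ∈ Finset.range N, (a + b * Q ^ t) =
      ∑ r ∈ Finset.range (N + 1),
        Q ^ r.choose 2 * gaussBinom Q N r * a ^ (N - r) * b ^ r := by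
  induction N generalizing b with
  | zero => simp
  | succ N ih =>
    have hstep : ∏ t ∈ Finset.range N, (a + b * Q ^ (t + 1)) =
        ∑ r ∈ Finset.range (N + 1),
          Q ^ r.choose 2 * gaussBinom Q N r * a ^ (N - r) * (b * Q) ^ r := by
      rw [← ih (b * Q)]
      exact Finset.prod_congr rfl fun t _ => by ring
    have hlast : ∑ r ∈ Finset.range (N + 1),
        Q ^ r.choose 2 * gaussBinom Q N r * a ^ (N - r) * (b * Q) ^ r * a =
        a ^ (N + 1) + ∑ r ∈ Finset.range (N + 1), Q ^ (r + 1).choose 2 *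
          (Q ^ (r + 1) * gaussBinom Q N (r + 1)) * a ^ (N - r) * b ^ (r + 1) := by
      rw [Finset.sum_range_succ', Finset.sum_range_succ, gaussBinom_eq_zero Q N.lt_succ_self,
        add_comm]
      congr 1
      · simp [pow_succ]
      · rw [mul_zero, mul_zero, zero_mul, zero_mul, add_zero]
        refine Finset.sum_congr rfl fun r hr => ?_
        rw [Finset.mem_range] at hr
        rw [show N - r = N - (r + 1) + 1 by omega]
        ring
    rw [Finset.prod_range_succ', hstep, pow_zero, mul_one, mul_add, Finset.sum_mul, hlast,
      Finset.sum_mul, add_assoc, ← Finset.sum_add_distrib, Finset.sum_range_succ' (n := N + 1), add_comm]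
    congr 1
    · refine Finset.sum_congr rfl fun r _ => ?_
      rw [gaussBinom, Nat.add_sub_add_right, Nat.choose_succ_succ' r 1, Nat.choose_one_right]
      ring
    · simp

theorem gaussBinom_mul_prod (Q : R) (r d : ℕ) :
    gaussBinom Q (r + d) r * ∏ s ∈ Finset.range r, (1 - Q ^ (s + 1)) =
      ∏ s ∈ Finset.range r, (1 - Q ^ (d + s + 1)) := by
  induction r generalizing d with
  | zero => simp
  | succ r ihr =>
    induction d with
    | zero =>
      have := ihr 0
      rw [add_zero, gaussBinom, gaussBinom_eq_zero Q r.lt_succ_self, mul_zero, add_zero,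
        Finset.prod_range_succ, Finset.prod_range_succ, ← mul_assoc]
      rw [add_zero] at this
      rw [this, zero_add]
    | succ d ihd =>
      have h1 := ihr (d + 1)
      have h2 : ∏ s ∈ Finset.range (r + 1), (1 - Q ^ (d + s + 1)) =
          (∏ s ∈ Finset.range r, (1 - Q ^ (d + 1 + s + 1))) * (1 - Q ^ (d + 1)) := by
        rw [Finset.prod_range_succ', add_zero]
        congr 1
        exact Finset.prod_congr rfl fun s _ => by rw [show d + (s + 1) = d + 1 + s by ring]
      rw [h2] at ihd
      rw [show r + 1 + (d + 1) = r + (d + 1) + 1 by ring, gaussBinom, add_mul,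
        Finset.prod_range_succ (n := r) (f := fun s => 1 - Q ^ (d + 1 + s + 1)), ← h1,
        show r + (d + 1) = r + 1 + d by ring, mul_assoc (Q ^ (r + 1)), ihd,
        show d + 1 + r + 1 = r + 1 + (d + 1) by ring, Finset.prod_range_succ, ← h1,
        show r + (d + 1) = r + 1 + d by ring]
      ring

/-- In the limit the Gaussian binomial coefficients become `1 / (Q; Q)_∞`. -/
theorem pow_dvd_gaussBinom_mul_prod_sub_one (Q : R) {m r d n : ℕ} (hr : m ≤ r) (hd : m ≤ d)
    (hn : m ≤ n) :
    Q ^ (m + 1) ∣ gaussBinom Q (r + d) r * ∏ s ∈ Finset.range n, (1 - Q ^ (s + 1)) - 1 := by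
  have hfac : ∀ e, m ≤ e → ∀ N, Q ^ (m + 1) ∣ ∏ s ∈ Finset.range N, (1 - Q ^ (e + s + 1)) - 1 :=
    fun e he N => dvd_prod_sub_one _ fun s _ => by
      rw [sub_sub_cancel_left, dvd_neg]
      exact pow_dvd_pow Q (by omega)
  have h := gaussBinom_mul_prod Q r d
  rcases le_total r n with hrn | hrn
  · obtain ⟨e, rfl⟩ := Nat.exists_eq_add_of_le hrn
    rw [Finset.prod_range_add, ← mul_assoc, h]
    exact dvd_mul_sub_one (hfac d hd r) (hfac r hr e)
  · obtain ⟨e, rfl⟩ := Nat.exists_eq_add_of_le hrn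
    rw [Finset.prod_range_add, ← mul_assoc] at h
    have h1 := hfac d hd (n + e)
    have h2 := hfac n hn e
    rw [← h] at h1
    generalize gaussBinom Q (n + e + d) (n + e) * ∏ s ∈ Finset.range n, (1 - Q ^ (s + 1)) = y at *
    have := dvd_sub h1 (h2.mul_left y)
    convert this using 1
    ring

end GaussBinom

/-! ### The Jacobi triple product -/

section TripleProduct

open PowerSeries Filter Topology
open scoped PowerSeries.WithPiTopology

theorem two_mul_choose_two (r : ℕ) : 2 * r.choose 2 + r = r ^ 2 := by
  induction r with
  | zero => rfl
  | succ r ih =>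
    rw [Nat.choose_succ_succ' r 1, Nat.choose_one_right]
    linarith

/-- The finite form of the triple product: the `Q`-binomial theorem with `Q = q^{2k}` for the
product of the `q^{2kn+u} - Q^t`, `0 ≤ t ≤ 2n`, where `k = e + u`. -/
theorem finite_triple_product (e u n : ℕ) :
    (∏ t ∈ Finset.range n, (1 - (X : ℂ⟦X⟧) ^ (2 * (e + u) * t + (2 * e + u)))) *
      ∏ t ∈ Finset.range (n + 1), (1 - X ^ (2 * (e + u) * t + u)) =
    ∑ l ∈ Finset.range (n + 1), (-1) ^ l * X ^ ((e + u) * l ^ 2 + e * l) *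
      (gaussBinom (X ^ (2 * (e + u))) (2 * n + 1) (n + 1 + l) -
        X ^ (u * (2 * l + 1)) * gaussBinom (X ^ (2 * (e + u))) (2 * n + 1) (n - l)) := by
  set Q : ℂ⟦X⟧ := X ^ (2 * (e + u)) with hQ
  have h := prod_add_mul_pow Q (X ^ (2 * (e + u) * n + u)) (-1) (2 * n + 1)
  rw [show 2 * n + 1 = (n + 1) + n by ring, Finset.prod_range_add, ← Finset.prod_range_reflect,
    show n + 1 + n + 1 = (n + 1) + (n + 1) by ring, Finset.sum_range_add,
    ← Finset.sum_range_reflect, ← Finset.sum_add_distrib] at h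
  -- For `t ≤ n` the term `Q^t` has the lower degree and is factored out, for `t > n` the other one;
  -- `hc1` and `hc2` extract the same monomial from the summands.
  have hP1 : ∏ t ∈ Finset.range (n + 1),
      (X ^ (2 * (e + u) * n + u) + -1 * Q ^ (n + 1 - 1 - t)) =
      (-1) ^ (n + 1) * X ^ ((e + u) * (n * (n + 1))) *
        ∏ t ∈ Finset.range (n + 1), (1 - X ^ (2 * (e + u) * t + u)) := by
    have hpow : ∏ t ∈ Finset.range (n + 1), (-1) * Q ^ (n + 1 - 1 - t) =
        (-1) ^ (n + 1) * X ^ ((e + u) * (n * (n + 1))) := by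
      rw [Finset.prod_mul_distrib, Finset.prod_range_reflect (fun t => Q ^ t),
        Finset.prod_pow_eq_pow_sum, hQ, ← pow_mul, mul_comm 2, mul_assoc (e + u), mul_comm 2,
        Finset.sum_range_id_mul_two, Nat.add_sub_cancel, mul_comm (n + 1)]
      simp
    rw [← hpow, ← Finset.prod_mul_distrib]
    refine Finset.prod_congr rfl fun t ht => ?_
    rw [Finset.mem_range] at ht
    obtain ⟨s, rfl⟩ := Nat.exists_eq_add_of_le (Nat.le_of_lt_succ ht)
    rw [show t + s + 1 - 1 - t = s by omega, hQ]
    ring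
  have hP2 : ∏ t ∈ Finset.range n, (X ^ (2 * (e + u) * n + u) + -1 * Q ^ (n + 1 + t)) =
      X ^ ((2 * (e + u) * n + u) * n) *
        ∏ t ∈ Finset.range n, (1 - X ^ (2 * (e + u) * t + (2 * e + u))) := by
    rw [pow_mul, ← Finset.card_range n, ← Finset.prod_const, Finset.card_range,
      ← Finset.prod_mul_distrib]
    refine Finset.prod_congr rfl fun t _ => ?_
    rw [hQ]
    ring
  rw [hP1, hP2] at h
  have hX : (-1) ^ (n + 1) * (X : ℂ⟦X⟧) ^ ((e + u) * (n * (n + 1))) *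
      X ^ ((2 * (e + u) * n + u) * n) ≠ 0 := by
    refine mul_ne_zero (mul_ne_zero ?_ (pow_ne_zero _ X_ne_zero)) (pow_ne_zero _ X_ne_zero)
    exact pow_ne_zero _ (neg_ne_zero.2 one_ne_zero)
  apply mul_left_cancel₀ hX
  trans ((-1) ^ (n + 1) * X ^ ((e + u) * (n * (n + 1))) *
        ∏ t ∈ Finset.range (n + 1), (1 - X ^ (2 * (e + u) * t + u))) *
      (X ^ ((2 * (e + u) * n + u) * n) *
        ∏ t ∈ Finset.range n, (1 - X ^ (2 * (e + u) * t + (2 * e + u))))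
  · ring
  rw [h, Finset.mul_sum]
  refine Finset.sum_congr rfl fun l hl => ?_
  rw [Finset.mem_range] at hl
  obtain ⟨p, rfl⟩ := Nat.exists_eq_add_of_le (Nat.le_of_lt_succ hl)
  rw [show l + p + 1 - 1 - l = p by omega, show l + p + 1 + (l + p) - p = 2 * l + p + 1 by omega,
    show l + p + 1 + (l + p) - (l + p + 1 + l) = p by omega, show l + p - l = p by omega]
  have hc1 : (Q : ℂ⟦X⟧) ^ p.choose 2 * (X ^ (2 * (e + u) * (l + p) + u)) ^ (2 * l + p + 1) =
      X ^ ((e + u) * ((l + p) * (l + p + 1))) * X ^ ((2 * (e + u) * (l + p) + u) * (l + p)) *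
        (X ^ ((e + u) * l ^ 2 + e * l) * X ^ (u * (2 * l + 1))) := by
    rw [hQ, ← pow_mul, ← pow_mul, ← pow_add, ← pow_add, ← pow_add, ← pow_add]
    congr 1
    have := two_mul_choose_two p
    zify at this ⊢
    linear_combination (e + u : ℤ) * this
  have hc2 : (Q : ℂ⟦X⟧) ^ (l + p + 1 + l).choose 2 * (X ^ (2 * (e + u) * (l + p) + u)) ^ p =
      X ^ ((e + u) * ((l + p) * (l + p + 1))) * X ^ ((2 * (e + u) * (l + p) + u) * (l + p)) *
        X ^ ((e + u) * l ^ 2 + e * l) := by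
    rw [hQ, ← pow_mul, ← pow_mul, ← pow_add, ← pow_add, ← pow_add]
    congr 1
    have := two_mul_choose_two (l + p + 1 + l)
    zify at this ⊢
    linear_combination (e + u : ℤ) * this
  have hs1 : (-1 : ℂ⟦X⟧) ^ p = - ((-1) ^ (l + p + 1) * (-1) ^ l) := by
    rw [← pow_add, show l + p + 1 + l = p + 1 + 2 * l by ring, pow_add, pow_mul]
    simp [pow_succ]
  have hs2 : (-1 : ℂ⟦X⟧) ^ (l + p + 1 + l) = (-1) ^ (l + p + 1) * (-1) ^ l := pow_add _ _ _
  rw [mul_right_comm (Q ^ p.choose 2), mul_right_comm (Q ^ (l + p + 1 + l).choose 2), hc1, hc2,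
    hs1, hs2]
  ring_nf

theorem thetaFactor_eq (e : ℕ) {u : ℕ} (hu : 1 ≤ u) (m : ℕ) :
    thetaFactor (e + u) (e + 1) (m + 1) =
      (1 - (X ^ (2 * (e + u))) ^ (m + 1)) * (1 - X ^ (2 * (e + u) * m + (2 * e + u))) *
        (1 - X ^ (2 * (e + u) * m + u)) := by
  have h : 2 * (e + u) * (m + 1) = 2 * (e + u) * m + 2 * (e + u) := by ring
  rw [thetaFactor, ← pow_mul, h]
  generalize 2 * (e + u) * m = y
  rw [show y + 2 * (e + u) - (e + u) + (e + 1) - 1 = y + (2 * e + u) by omega,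
    show y + 2 * (e + u) - (e + u) - (e + 1) + 1 = y + u by omega]

theorem thetaProd_eq_shelfSum {k i : ℕ} (hi : 1 ≤ i) (hik : i ≤ k) :
    thetaProd k i = shelfSum k 0 i := by
  obtain ⟨e, rfl⟩ : ∃ e, i = e + 1 := ⟨i - 1, by omega⟩
  obtain ⟨u, rfl⟩ : ∃ u, k = e + u := ⟨k - e, by omega⟩
  have hu : 1 ≤ u := by omega
  refine eq_of_tendsto_of_X_pow_dvd
    (multipliable_thetaProd (e + u) (e + 1) hi hik).hasProd.tendsto_prod_nat
    ((summable_shelfTerm (by omega) 0 (e + 1)).hasSum.tendsto_sum_nat.comp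
      (tendsto_add_atTop_nat 1)) fun n => ?_
  set Q : ℂ⟦X⟧ := X ^ (2 * (e + u)) with hQ
  have h1 : (∏ m ∈ Finset.range n, thetaFactor (e + u) (e + 1) (m + 1)) *
      (1 - X ^ (2 * (e + u) * n + u)) =
      ∑ l ∈ Finset.range (n + 1), (-1) ^ l * X ^ ((e + u) * l ^ 2 + e * l) *
        (gaussBinom Q (2 * n + 1) (n + 1 + l) * (∏ s ∈ Finset.range n, (1 - Q ^ (s + 1))) -
          X ^ (u * (2 * l + 1)) * (gaussBinom Q (2 * n + 1) (n - l) *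
            ∏ s ∈ Finset.range n, (1 - Q ^ (s + 1)))) := by
    have := finite_triple_product e u n
    rw [Finset.prod_range_succ] at this
    simp only [thetaFactor_eq e hu, Finset.prod_mul_distrib]
    rw [mul_assoc, mul_assoc, this, Finset.mul_sum]
    refine Finset.sum_congr rfl fun l _ => ?_
    ring
  have h2 : X ^ n ∣ (∏ m ∈ Finset.range n, thetaFactor (e + u) (e + 1) (m + 1)) *
      (1 - X ^ (2 * (e + u) * n + u)) -
      ∑ l ∈ Finset.range (n + 1), shelfTerm (e + u) 0 (e + 1) l := by
    rw [h1, ← Finset.sum_sub_distrib]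
    refine Finset.dvd_sum fun l hl => ?_
    rw [Finset.mem_range] at hl
    have hb : ∀ r d, n - l ≤ r → n - l ≤ d → r + d = 2 * n + 1 →
        X ^ n ∣ X ^ ((e + u) * l ^ 2 + e * l) *
          (gaussBinom Q (2 * n + 1) r * (∏ s ∈ Finset.range n, (1 - Q ^ (s + 1))) - 1) := by
      intro r d hr hd hrd
      have := pow_dvd_gaussBinom_mul_prod_sub_one Q hr hd (Nat.sub_le n l)
      rw [hrd, hQ, ← pow_mul] at this
      refine Dvd.dvd.trans ?_ (mul_dvd_mul_left _ this)
      rw [← pow_add]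
      refine pow_dvd_pow X ?_
      obtain ⟨p, rfl⟩ := Nat.exists_eq_add_of_le (Nat.le_of_lt_succ hl)
      rw [show l + p - l = p by omega]
      -- The exponent is at least `k (l² + 2 (n - l + 1))`, and `l² + 2 (n - l + 1) ≥ n`.
      have hl2 : l ≤ l ^ 2 := Nat.le_self_pow two_ne_zero l
      have : 1 * (l + p) ≤ (e + u) * (l ^ 2 + 2 * (p + 1)) :=
        Nat.mul_le_mul (by omega) (by omega)
      nlinarith [Nat.zero_le (e * l)]
    have hb1 := (hb (n + 1 + l) (n - l) (by omega) le_rfl (by omega)).mul_left ((-1) ^ l)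
    have hb2 := (hb (n - l) (n + 1 + l) le_rfl (by omega) (by omega)).mul_left
      ((-1) ^ l * X ^ (u * (2 * l + 1)))
    convert dvd_sub hb1 hb2 using 1
    rw [shelfTerm, show e + u + 1 - (e + 1) = u by omega, Nat.add_sub_cancel, mul_zero, zero_add,
      add_zero, evenProd, Finset.prod_range_zero]
    ring
  have h3 : X ^ n ∣ (∏ m ∈ Finset.range n, thetaFactor (e + u) (e + 1) (m + 1)) *
      X ^ (2 * (e + u) * n + u) := by
    refine (pow_dvd_pow X ?_).mul_left _
    have : 1 * n ≤ 2 * (e + u) * n := Nat.mul_le_mul_right n (by omega)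
    omega
  convert dvd_add h2 h3 using 1
  simp only [Function.comp_apply]
  ring

end TripleProduct

/-! ### The official series -/

theorem mul_shelf_difference {K : Type*} [Field K] (A C E : K) {v w : K} (hw1 : 1 + w ≠ 0)
    (hw : w ≠ 0) (hv : v ≠ 0) :
    v * ((A - (A + w * C) / (1 + w)) / (v * w) * (E * (1 + w))) = A * E - C * E := by
  field_simp
  ring

/-- The official series are the quotients of the alternating series by `shelfDenom`. -/
theorem officialShelf_mul_shelfDenom {k : ℕ} (hk : 2 ≤ k) (j : ℕ) {i : ℕ} (hi : 1 ≤ i)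
    (hik : i ≤ k) :
    officialShelf k j i * ((shelfDenom j : ℂ⟦X⟧) : ℂ⸨X⸩) = ((shelfSum k j i : ℂ⟦X⟧) : ℂ⸨X⸩) := by
  have hden : ∀ j, ((shelfDenom (j + 1) : ℂ⟦X⟧) : ℂ⸨X⸩) =
      ((shelfDenom j : ℂ⟦X⟧) : ℂ⸨X⸩) * (1 + q ^ (j + 1)) := fun j => by
    rw [shelfDenom_succ]
    simp [q]
  induction j generalizing i with
  | zero =>
    have hq : ((qInf : ℂ⟦X⟧) : ℂ⸨X⸩) ≠ 0 := fun h0 =>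
      PowerSeries.WithPiTopology.tprod_one_sub_X_pow_ne_zero ℂ
        (HahnSeries.ofPowerSeries_injective (Γ := ℤ) (h0.trans (map_zero _).symm))
    rw [shelfDenom, Finset.prod_range_zero, mul_one, officialShelf, div_mul_cancel₀ _ hq,
      thetaProd_eq_shelfSum hi hik]
  | succ j ih =>
    have hw := one_add_q_pow_ne_zero j
    rcases hi.eq_or_lt with rfl | hi
    · rw [officialShelf, if_pos rfl, hden, ← mul_assoc, ih (by omega) le_rfl,
        ← shelfSum_succ_one (by omega)]
      simp [q, mul_comm]
    · -- With the convention that the series at `k + 1` vanishes, both cases of the definition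
      -- of the ghosts have the same form.
      obtain ⟨C, hC, hg⟩ : ∃ C : ℂ⸨X⸩, C * ((shelfDenom j : ℂ⟦X⟧) : ℂ⸨X⸩) =
          ((shelfSum k j (k - i + 3) : ℂ⟦X⟧) : ℂ⸨X⸩) ∧
          ghostOf k j (officialShelf k j) (k - i + 2) =
            (officialShelf k j (k - i + 1) + q ^ (j + 1) * C) / (1 + q ^ (j + 1)) := by
        rcases Nat.lt_or_ge 2 i with h2 | h2
        · refine ⟨officialShelf k j (k - i + 3), ih (by omega) (by omega), ?_⟩
          rw [ghostOf, if_neg (by omega)]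
          rfl
        · obtain rfl : i = 2 := by omega
          refine ⟨0, ?_, ?_⟩
          · rw [show k - 2 + 3 = k + 1 by omega, shelfSum_last]
            simp
          · rw [ghostOf, if_pos (by omega), show k - 2 + 1 = k - 1 by omega, mul_zero, add_zero]
      have hA := ih (i := k - i + 1) (by omega) (by omega)
      have hs : q ^ ((j + 1) * (i - 2)) * ((shelfSum k (j + 1) i : ℂ⟦X⟧) : ℂ⸨X⸩) =
          officialShelf k j (k - i + 1) * ((shelfDenom j : ℂ⟦X⟧) : ℂ⸨X⸩) -
            C * ((shelfDenom j : ℂ⟦X⟧) : ℂ⸨X⸩) := by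
        rw [hA, hC, ← map_sub, shelfSum_sub hi hik j, map_mul, map_pow]
        rfl
      have hv : q ^ ((j + 1) * (i - 2)) ≠ 0 := pow_ne_zero _ q_ne_zero
      have hq : q ^ (j + 1) ≠ 0 := pow_ne_zero _ q_ne_zero
      rw [officialShelf, if_neg (by omega), hden, hg,
        show (j + 1) * (i - 1) = (j + 1) * (i - 2) + (j + 1) by
          rw [← Nat.mul_succ, show (i - 2).succ = i - 1 by omega], pow_add q _ (j + 1)]
      apply mul_left_cancel₀ hv
      rw [hs]
      exact mul_shelf_difference _ _ _ hw hq hv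

theorem shelfDenom_ne_zero (j : ℕ) : ((shelfDenom j : ℂ⟦X⟧) : ℂ⸨X⸩) ≠ 0 := by
  intro h0
  have h : shelfDenom j = 0 :=
    HahnSeries.ofPowerSeries_injective (Γ := ℤ) (h0.trans (map_zero _).symm)
  rw [shelfDenom, mul_eq_zero, Finset.prod_eq_zero_iff] at h
  rcases h with h | ⟨s, _, h⟩
  · exact PowerSeries.WithPiTopology.tprod_one_sub_X_pow_ne_zero ℂ h
  · have := congrArg PowerSeries.constantCoeff h
    simp at this

end AndrewsBressoud

theorem mainTheorem2 (k : ℕ) (hk : 2 ≤ k) (J i r : ℕ) (hi : 1 ≤ i) (hik : i ≤ k)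
    (hr : r = (k - 1) * J + i) :
    AndrewsBressoud.officialSeries k r =
      ((PowerSeries.mk fun n => (AndrewsBressoud.admissibleCount k J i n : ℂ) : ℂ⟦X⟧) : ℂ⸨X⸩) := by
  rw [hr, AndrewsBressoud.series_eq_shelf k J i hk hi hik,
    ← AndrewsBressoud.admissibleGF_eq hk]
  apply mul_right_cancel₀ (AndrewsBressoud.shelfDenom_ne_zero J)
  rw [AndrewsBressoud.officialShelf_mul_shelfDenom hk J hi hik,
    AndrewsBressoud.shelfSum_eq hk hi hik, map_mul, mul_comm]
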